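/- Let $H_1, H_2$ be infinite-dimensional complex Hilbert spaces (not necessarily separable) and let $T\colon H_1\to H_2$ be a bounded linear operator. A bounded operator $S\colon M\to H_2$ on a nonzero complex Hilbert space $M$ is called minimum attaining if there is a unit vector $x_0\in M$ with $\|Sx_0\|=\inf\{\|Sx\| : x\in M,\ \|x\|=1\}$, and $T$ is called absolutely minimum attaining if the restriction $T|_M\colon M\to H_2$ is minimum attaining for every nonzero closed subspace $M$ of $H_1$. Write $N(\cdot)$ for the null space. Then the following are equivalent: 1. $T$ is absolutely minimum attaining; 2. there exist a real number $\alpha$, a positive compact operator $K$ on $H_1$ with $\|K\|\le\alpha$, a positive finite rank operator $F$ on $H_1$ with $KF=FK=0$, and a partial isometry $V\colon H_1\to H_2$ with $N(V)=N(\alpha I-K+F)$, such that $$T=V(\alpha I-K+F).$$ Moreover, this decomposition is unique: if $(V,\alpha,K,F)$ and $(V',\alpha',K',F')$ are both as in (2) for the same $T$, then $V=V'$, $\alpha=\alpha'$, $K=K'$ and $F=F'$. -/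

import Mathlib

/-- The minimum modulus `m(T) = inf {‖T x‖ : ‖x‖ = 1}` of a bounded operator. -/
noncomputable def minimumModulus {E F : Type*} [NormedAddCommGroup E] [InnerProductSpace ℂ E]
    [NormedAddCommGroup F] [InnerProductSpace ℂ F] (T : E →L[ℂ] F) : ℝ :=
  sInf {r : ℝ | ∃ x : E, ‖x‖ = 1 ∧ r = ‖T x‖}

/-- `T` is minimum attaining: `‖T x₀‖ = m(T)` for some unit vector `x₀`. -/
def IsMinimumAttaining {E F : Type*} [NormedAddCommGroup E] [InnerProductSpace ℂ E]
    [NormedAddCommGroup F] [InnerProductSpace ℂ F] (T : E →L[ℂ] F) : Prop :=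
  ∃ x₀ : E, ‖x₀‖ = 1 ∧ ‖T x₀‖ = minimumModulus T

/-- `T` is absolutely minimum attaining: the restriction `T|_M : M → F` is minimum attaining for
every nonzero closed subspace `M` of the domain. -/
def IsAbsolutelyMinimumAttaining {E F : Type*} [NormedAddCommGroup E] [InnerProductSpace ℂ E]
    [NormedAddCommGroup F] [InnerProductSpace ℂ F] (T : E →L[ℂ] F) : Prop :=
  ∀ M : Submodule ℂ E, IsClosed (M : Set E) → M ≠ ⊥ → IsMinimumAttaining (T.comp M.subtypeL)

/-- `V` is a partial isometry: it is isometric on the orthogonal complement of its null space. -/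
def IsPartialIsometry {E F : Type*} [NormedAddCommGroup E] [InnerProductSpace ℂ E]
    [NormedAddCommGroup F] [InnerProductSpace ℂ F] (V : E →L[ℂ] F) : Prop :=
  ∀ x ∈ (LinearMap.ker (V : E →ₗ[ℂ] F))ᗮ, ‖V x‖ = ‖x‖

/-- `F` is a finite rank operator: its range is finite dimensional. -/
def IsFiniteRankOperator {E G : Type*} [NormedAddCommGroup E] [InnerProductSpace ℂ E]
    [NormedAddCommGroup G] [InnerProductSpace ℂ G] (F : E →L[ℂ] G) : Prop :=
  FiniteDimensional ℂ (LinearMap.range (F : E →ₗ[ℂ] G))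

/-- `(V, α, K, F)` is a decomposition `T = V (α I - K + F)` with `K` positive compact, `‖K‖ ≤ α`
(so `α ≥ 0`), `F` positive of finite rank, `K F = F K = 0`, and `V` a partial isometry with
`N(V) = N(α I - K + F)`. -/
structure IsAMDecomposition {H₁ H₂ : Type*} [NormedAddCommGroup H₁] [InnerProductSpace ℂ H₁]
    [CompleteSpace H₁] [NormedAddCommGroup H₂] [InnerProductSpace ℂ H₂] [CompleteSpace H₂]
    (T V : H₁ →L[ℂ] H₂) (α : ℝ) (K F : H₁ →L[ℂ] H₁) : Prop where
  compact : IsCompactOperator K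
  positive_compact : K.IsPositive
  norm_le : ‖K‖ ≤ α
  finiteRank : IsFiniteRankOperator F
  positive_finiteRank : F.IsPositive
  mul_zero_left : K.comp F = 0
  mul_zero_right : F.comp K = 0
  partialIsometry : IsPartialIsometry V
  ker_eq : LinearMap.ker (V : H₁ →ₗ[ℂ] H₂) =
    LinearMap.ker (((α : ℂ) • ContinuousLinearMap.id ℂ H₁ - K + F : H₁ →L[ℂ] H₁) : H₁ →ₗ[ℂ] H₁)
  eq_comp : T = V.comp ((α : ℂ) • ContinuousLinearMap.id ℂ H₁ - K + F)

/-! Being absolutely minimum attaining depends only on the function `x ↦ ‖T x‖`, so everything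
reduces to a positive operator: `|T|` on one side, `P = αI - K + F` on the other.

Sufficiency: for `Q = P|_M`, `Q*Q` is `α²` minus a compact operator. If `m(Q) < α`, the Fredholm
alternative makes `m(Q)²` an eigenvalue of `Q*Q` (`isMinimumAttaining_of_compact_perturbation`).
Otherwise any nonzero vector of `M ∩ ker F` is a minimizer, and if there is none, `M` is finite
dimensional.

Necessity: a minimizer of `S = |T|` on an invariant closed subspace is an eigenvector, so Zorn gives
an eigenbasis. The key obstruction is `not_strictAnti`: no orthonormal sequence with orthogonal
images has strictly decreasing image norms. It forces the eigenvalues to be well ordered, with only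
one possible accumulation level `α`, finitely many of them above `α` and finitely many below each `α
- ε`. Then `F` and `K` are the positive and negative parts of `S - αI`, and `V` comes from polar
decomposition.

Uniqueness: `P = |T|`, `α` is determined modulo compact operators, `F` and `K` are the two parts of
`P - αI`, and `V` is fixed on `ker P` and on the closure of the range of `P`. -/

open scoped InnerProductSpace
open ContinuousLinearMap

/-! ### Minimum modulus, compactness and positivity -/

section Basics

variable {E G : Type*} [NormedAddCommGroup E] [InnerProductSpace ℂ E]
  [NormedAddCommGroup G] [InnerProductSpace ℂ G]

lemma minimumModulus_mul_norm_le (T : E →L[ℂ] G) (x : E) : minimumModulus T * ‖x‖ ≤ ‖T x‖ := by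
  rcases eq_or_ne x 0 with rfl | hx
  · simp
  have hx' : 0 < ‖x‖ := norm_pos_iff.2 hx
  have hb : BddBelow {r : ℝ | ∃ x : E, ‖x‖ = 1 ∧ r = ‖T x‖} :=
    ⟨0, by rintro _ ⟨y, -, rfl⟩; exact norm_nonneg _⟩
  have h : minimumModulus T ≤ ‖T (((‖x‖⁻¹ : ℝ) : ℂ) • x)‖ :=
    csInf_le hb ⟨_, by simp [norm_smul, hx'.ne'], rfl⟩
  rw [map_smul, norm_smul, Complex.norm_real, norm_inv, norm_norm, ← div_eq_inv_mul,
    le_div_iff₀ hx'] at h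
  exact h

lemma minimumModulus_nonneg (T : E →L[ℂ] G) : 0 ≤ minimumModulus T :=
  Real.sInf_nonneg (by rintro _ ⟨y, -, rfl⟩; exact norm_nonneg _)

lemma exists_norm_lt_of_minimumModulus_lt [Nontrivial E] (T : E →L[ℂ] G) {r : ℝ}
    (h : minimumModulus T < r) : ∃ x : E, ‖x‖ = 1 ∧ ‖T x‖ < r := by
  obtain ⟨x, hx⟩ := exists_norm_eq E zero_le_one
  obtain ⟨_, ⟨y, hy, rfl⟩, hlt⟩ := exists_lt_of_csInf_lt
    (s := {r : ℝ | ∃ x : E, ‖x‖ = 1 ∧ r = ‖T x‖}) ⟨_, x, hx, rfl⟩ h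
  exact ⟨y, hy, hlt⟩

lemma IsMinimumAttaining.of_norm_le {T : E →L[ℂ] G} {x : E} (hx : x ≠ 0)
    (h : ‖T x‖ ≤ minimumModulus T * ‖x‖) : IsMinimumAttaining T := by
  have hx' : 0 < ‖x‖ := norm_pos_iff.2 hx
  have hm := le_antisymm h (minimumModulus_mul_norm_le T x)
  refine ⟨((‖x‖⁻¹ : ℝ) : ℂ) • x, by simp [norm_smul, hx'.ne'], ?_⟩
  rw [map_smul, norm_smul, hm, Complex.norm_real, norm_inv, norm_norm]
  field_simp

lemma IsAbsolutelyMinimumAttaining.congr_norm {G' : Type*} [NormedAddCommGroup G']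
    [InnerProductSpace ℂ G'] {T : E →L[ℂ] G} {S : E →L[ℂ] G'} (h : ∀ x, ‖S x‖ = ‖T x‖)
    (hT : IsAbsolutelyMinimumAttaining T) : IsAbsolutelyMinimumAttaining S := by
  intro M hM hM0
  obtain ⟨x, hx, hmin⟩ := hT M hM hM0
  refine ⟨x, hx, ?_⟩
  simpa [minimumModulus, h] using hmin

lemma IsMinimumAttaining.of_finiteDimensional [FiniteDimensional ℂ E] [Nontrivial E]
    (T : E →L[ℂ] G) : IsMinimumAttaining T := by
  have : ProperSpace E := FiniteDimensional.proper ℂ E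
  obtain ⟨u, hu⟩ := exists_norm_eq E zero_le_one
  obtain ⟨x, hx, hmin⟩ := (isCompact_sphere (0 : E) 1).exists_isMinOn ⟨u, by simpa using hu⟩
    (f := fun x => ‖T x‖) (by fun_prop)
  have hx1 : ‖x‖ = 1 := by simpa using hx
  refine ⟨x, hx1, le_antisymm (le_csInf ⟨_, u, hu, rfl⟩ ?_) ?_⟩
  · rintro _ ⟨y, hy, rfl⟩
    exact hmin (by simpa using hy)
  · simpa [hx1] using minimumModulus_mul_norm_le T x

/-- If `a ≠ b`, the identity is a multiple of the compact operator `A - B`, which forces finite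
dimension. -/
lemma eq_of_compact_sub {A B : E →L[ℂ] E} {a b : ℝ} (hE : ¬ FiniteDimensional ℂ E)
    (hA : IsCompactOperator A) (hB : IsCompactOperator B)
    (h : (a : ℂ) • ContinuousLinearMap.id ℂ E - A = (b : ℂ) • ContinuousLinearMap.id ℂ E - B) :
    a = b := by
  by_contra hab
  have hne : ((a : ℂ) - b) ≠ 0 := by
    rw [sub_ne_zero]; exact_mod_cast hab
  apply hE
  refine FiniteDimensional.of_isCompactOperator_id (𝕜 := ℂ) (E := E) ?_
  have hid : (id : E → E) = ((a : ℂ) - b)⁻¹ • (⇑A - ⇑B) := by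
    funext x
    have hx : (a : ℂ) • x - A x = (b : ℂ) • x - B x := by simpa using DFunLike.congr_fun h x
    have : A x - B x = ((a : ℂ) - b) • x := by
      rw [sub_smul, sub_eq_sub_iff_add_eq_add]
      rw [sub_eq_sub_iff_add_eq_add] at hx
      rw [add_comm, ← hx]
    simp [this, hne]
  rw [hid]
  exact (hA.sub hB).smul _

lemma IsFiniteRankOperator.isCompactOperator {F : E →L[ℂ] G} (hF : IsFiniteRankOperator F) :
    IsCompactOperator F := by
  have : FiniteDimensional ℂ (LinearMap.range (F : E →ₗ[ℂ] G)) := hF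
  have : ProperSpace (LinearMap.range (F : E →ₗ[ℂ] G)) := FiniteDimensional.proper ℂ _
  have h : IsCompactOperator
      (F.codRestrict (LinearMap.range (F : E →ₗ[ℂ] G)) fun x => ⟨x, rfl⟩) :=
    isCompactOperator_of_locallyCompactSpace_dom
      (F.codRestrict (LinearMap.range (F : E →ₗ[ℂ] G)) fun x => ⟨x, rfl⟩)
  exact h.clm_comp (LinearMap.range (F : E →ₗ[ℂ] G)).subtypeL

variable [CompleteSpace E] [CompleteSpace G]

/-- With `R = √B`, `‖B x‖ ≤ ‖R‖ ‖R x‖` and `‖R x‖² = ⟪B x, x⟫`. Applied to `T*T - m²`, it shows that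
a vector attaining the minimum modulus lies in the kernel. -/
lemma ContinuousLinearMap.IsPositive.exists_norm_sq_apply_le {B : E →L[ℂ] E} (hB : B.IsPositive) :
    ∃ c > 0, ∀ x, ‖B x‖ ^ 2 ≤ c * (⟪B x, x⟫_ℂ).re := by
  have hB0 : 0 ≤ B := (nonneg_iff_isPositive B).2 hB
  set R := CFC.sqrt B with hR
  have hRp : R.IsPositive := (nonneg_iff_isPositive R).1 (CFC.sqrt_nonneg B)
  have hRR : ∀ x, R (R x) = B x := DFunLike.congr_fun (CFC.sqrt_mul_sqrt_self B)
  -- The `+ 1` only keeps the constant positive when `R = 0`.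
  refine ⟨‖R‖ ^ 2 + 1, by positivity, fun x => ?_⟩
  have h1 : (⟪B x, x⟫_ℂ).re = ‖R x‖ ^ 2 := by
    rw [← hRR, hRp.inner_left_eq_inner_right]
    exact inner_self_eq_norm_sq (𝕜 := ℂ) _
  have h2 : ‖B x‖ ≤ ‖R‖ * ‖R x‖ := by
    rw [← hRR]; exact R.le_opNorm _
  rw [h1]
  nlinarith [mul_self_le_mul_self (norm_nonneg _) h2, sq_nonneg ‖R x‖]

lemma re_inner_adjoint_comp_self_sub (T : E →L[ℂ] G) (m : ℝ) (x : E) :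
    (⟪((adjoint T).comp T - ((m ^ 2 : ℝ) : ℂ) • ContinuousLinearMap.id ℂ E) x, x⟫_ℂ).re =
      ‖T x‖ ^ 2 - m ^ 2 * ‖x‖ ^ 2 := by
  have h1 : (⟪T x, T x⟫_ℂ).re = ‖T x‖ ^ 2 := inner_self_eq_norm_sq (𝕜 := ℂ) _
  have h2 : (⟪x, x⟫_ℂ).re = ‖x‖ ^ 2 := inner_self_eq_norm_sq (𝕜 := ℂ) _
  simp only [sub_apply, smul_apply, ContinuousLinearMap.coe_comp, Function.comp_apply, id_apply, inner_sub_left,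
    adjoint_inner_left, inner_smul_left, Complex.conj_ofReal, Complex.sub_re, Complex.re_ofReal_mul,
    h1, h2]

lemma isSelfAdjoint_real_smul_id (c : ℝ) :
    IsSelfAdjoint ((c : ℂ) • ContinuousLinearMap.id ℂ E) :=
  IsSelfAdjoint.smul (Complex.conj_ofReal c) (IsSelfAdjoint.one (E →L[ℂ] E))

lemma isPositive_of_re_inner_nonneg {B : E →L[ℂ] E} (hB : IsSelfAdjoint B)
    (h : ∀ x, 0 ≤ (⟪B x, x⟫_ℂ).re) : B.IsPositive :=
  isPositive_def'.2 ⟨hB, h⟩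

lemma isPositive_adjoint_comp_self_sub (T : E →L[ℂ] G) {m : ℝ} (hm : 0 ≤ m)
    (h : ∀ x, m * ‖x‖ ≤ ‖T x‖) :
    ((adjoint T).comp T - ((m ^ 2 : ℝ) : ℂ) • ContinuousLinearMap.id ℂ E).IsPositive := by
  refine isPositive_of_re_inner_nonneg
    ((isPositive_adjoint_comp_self T).isSelfAdjoint.sub (isSelfAdjoint_real_smul_id _)) fun x => ?_
  rw [re_inner_adjoint_comp_self_sub, ← mul_pow]
  exact sub_nonneg.2 (pow_le_pow_left₀ (by positivity) (h x) 2)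

lemma isPositive_real_smul_id_sub {K : E →L[ℂ] E} (hK : IsSelfAdjoint K) {c : ℝ} (hc : ‖K‖ ≤ c) :
    ((c : ℂ) • ContinuousLinearMap.id ℂ E - K).IsPositive := by
  refine isPositive_of_re_inner_nonneg ((isSelfAdjoint_real_smul_id c).sub hK) fun x => ?_
  have h2 : (⟪x, x⟫_ℂ).re = ‖x‖ ^ 2 := inner_self_eq_norm_sq (𝕜 := ℂ) _
  have h3 : (⟪K x, x⟫_ℂ).re ≤ c * ‖x‖ ^ 2 := calc
    (⟪K x, x⟫_ℂ).re ≤ ‖⟪K x, x⟫_ℂ‖ := Complex.re_le_norm _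
    _ ≤ ‖K x‖ * ‖x‖ := norm_inner_le_norm _ _
    _ ≤ (c * ‖x‖) * ‖x‖ := by
      gcongr; exact (K.le_opNorm x).trans (by gcongr)
    _ = c * ‖x‖ ^ 2 := by ring
  simp only [sub_apply, smul_apply, id_apply, inner_sub_left, inner_smul_left, Complex.conj_ofReal,
    Complex.sub_re, Complex.re_ofReal_mul, h2]
  linarith

lemma norm_le_of_isPositive_of_isPositive_sub {K : E →L[ℂ] E} (hK : K.IsPositive) {c : ℝ}
    (hc : 0 ≤ c) (h : ((c : ℂ) • ContinuousLinearMap.id ℂ E - K).IsPositive) : ‖K‖ ≤ c := by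
  refine (CStarAlgebra.norm_le_iff_le_algebraMap K hc ((nonneg_iff_isPositive K).2 hK)).2 ?_
  rw [le_def]
  convert h using 2
  ext x
  simp [Algebra.algebraMap_eq_smul_one]

end Basics

/-! ### Compact perturbations of a scalar attain their minimum -/

section Sufficiency

variable {H G : Type*} [NormedAddCommGroup H] [InnerProductSpace ℂ H] [CompleteSpace H]
  [NormedAddCommGroup G] [InnerProductSpace ℂ G] [CompleteSpace G]

lemma isMinimumAttaining_of_compact_perturbation {Q : H →L[ℂ] G} [Nontrivial H] {C : H →L[ℂ] H}
    {a : ℝ} (hC : IsCompactOperator C)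
    (hQ : (adjoint Q).comp Q = ((a ^ 2 : ℝ) : ℂ) • ContinuousLinearMap.id ℂ H - C)
    (hlt : minimumModulus Q < a) : IsMinimumAttaining Q := by
  set m := minimumModulus Q with hm
  have hm0 : 0 ≤ m := minimumModulus_nonneg Q
  have hB := isPositive_adjoint_comp_self_sub Q hm0 (minimumModulus_mul_norm_le Q)
  have hre := re_inner_adjoint_comp_self_sub Q m
  set B := (adjoint Q).comp Q - ((m ^ 2 : ℝ) : ℂ) • ContinuousLinearMap.id ℂ H with hBdef
  have hBC : B = -(C - ((a ^ 2 - m ^ 2 : ℝ) : ℂ) • 1) := by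
    rw [hBdef, hQ]; ext x; simp [sub_smul]; abel
  have hμ : ((a ^ 2 - m ^ 2 : ℝ) : ℂ) ≠ 0 := by
    rw [Ne, Complex.ofReal_eq_zero]; nlinarith
  obtain ⟨c, hc, hle⟩ := hB.exists_norm_sq_apply_le
  -- Fredholm alternative for `C` at the nonzero scalar `a² - m²`: an eigenvector is killed by `B`
  -- and hence is a minimizer; without one, `B` is bounded below.
  by_cases hev : Module.End.HasEigenvalue (C : Module.End ℂ H) ((a ^ 2 - m ^ 2 : ℝ) : ℂ)
  · obtain ⟨x, hx⟩ := hev.exists_hasEigenvector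
    have hx1 : C x = ((a ^ 2 - m ^ 2 : ℝ) : ℂ) • x := hx.apply_eq_smul
    have hBx : B x = 0 := by rw [hBC]; simp [hx1]
    have h0 := hre x
    rw [hBx, inner_zero_left, Complex.zero_re] at h0
    refine IsMinimumAttaining.of_norm_le hx.2 ?_
    exact (abs_le_of_sq_le_sq' (by nlinarith) (by positivity)).2
  · obtain ⟨k, hk⟩ := IsCompactOperator.antilipschitz_of_not_hasEigenvalue hC hμ hev
    obtain ⟨d, hd, hdle⟩ := antilipschitzWith_iff_exists_mul_le_norm.1 ⟨k, hk⟩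
    have hdB : ∀ x, d * ‖x‖ ≤ ‖B x‖ := fun x => by
      rw [hBC, neg_apply, norm_neg]; exact hdle x
    -- Combining `d ≤ ‖B x‖` with `‖B x‖² ≤ c (‖Q x‖² - m²)` on unit vectors gives `‖Q x‖² ≥ m² +
    -- d²/c`, so `m` could not be the infimum.
    have hgap : m < √(m ^ 2 + d ^ 2 / c) := by
      apply Real.lt_sqrt_of_sq_lt
      have : 0 < d ^ 2 / c := by positivity
      linarith
    obtain ⟨x, hx, hlt⟩ := exists_norm_lt_of_minimumModulus_lt Q hgap
    have h1 : d ^ 2 ≤ c * (‖Q x‖ ^ 2 - m ^ 2) := by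
      have h2 := hle x
      rw [hre x, hx, one_pow, mul_one] at h2
      have h3 := hdB x
      rw [hx, mul_one] at h3
      exact (pow_le_pow_left₀ hd.le h3 2).trans h2
    have h4 := (Real.lt_sqrt (norm_nonneg _)).1 hlt
    rw [← div_le_iff₀' hc] at h1
    linarith

lemma isAbsolutelyMinimumAttaining_of_compact_finiteRank {α : ℝ} {K F : H →L[ℂ] H}
    (hKc : IsCompactOperator K) (hK : K.IsPositive) (hα : ‖K‖ ≤ α) (hFf : IsFiniteRankOperator F)
    (hF : F.IsPositive) :
    IsAbsolutelyMinimumAttaining ((α : ℂ) • ContinuousLinearMap.id ℂ H - K + F) := by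
  intro M hM hM0
  have hα0 : 0 ≤ α := (norm_nonneg K).trans hα
  set P := (α : ℂ) • ContinuousLinearMap.id ℂ H - K + F with hP
  have hPs : IsSelfAdjoint P :=
    ((isSelfAdjoint_real_smul_id α).sub hK.isSelfAdjoint).add hF.isSelfAdjoint
  have : CompleteSpace M := hM.completeSpace_coe
  have : Nontrivial M := (Submodule.nontrivial_iff_ne_bot).2 hM0
  set Q := P.comp M.subtypeL with hQ
  rcases lt_or_ge (minimumModulus Q) α with hlt | hge
  · set D : H →L[ℂ] H := K - F with hD
    have hDc : IsCompactOperator D := hKc.sub hFf.isCompactOperator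
    set C₀ : H →L[ℂ] H := ((2 * α : ℝ) : ℂ) • D - D.comp D with hC₀
    have hC₀c : IsCompactOperator C₀ := by
      refine IsCompactOperator.sub ?_ ?_
      · exact hDc.smul ((2 * α : ℝ) : ℂ)
      · exact hDc.comp_clm D
    have hPP : P.comp P = ((α ^ 2 : ℝ) : ℂ) • ContinuousLinearMap.id ℂ H - C₀ := by
      have hPD : P = (α : ℂ) • ContinuousLinearMap.id ℂ H - D := by rw [hP, hD]; abel
      rw [hPD, hC₀]
      ext x
      simp only [ContinuousLinearMap.coe_comp, Function.comp_apply, sub_apply, smul_apply, id_apply, map_sub, map_smul,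
        Complex.ofReal_mul, Complex.ofReal_pow, Complex.ofReal_ofNat]
      module
    refine isMinimumAttaining_of_compact_perturbation
      (C := (adjoint M.subtypeL).comp (C₀.comp M.subtypeL)) (a := α)
      ((hC₀c.comp_clm M.subtypeL).clm_comp (adjoint M.subtypeL)) ?_ hlt
    refine ContinuousLinearMap.ext fun x => ext_inner_right ℂ fun y => ?_
    have hPx : P (P x) = ((α ^ 2 : ℝ) : ℂ) • (x : H) - C₀ x := by
      simpa using DFunLike.congr_fun hPP (x : H)
    have hPa : ⟪P (x : H), P (y : H)⟫_ℂ = ⟪P (P x), (y : H)⟫_ℂ := by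
      conv_rhs => rw [← adjoint_inner_right, hPs.adjoint_eq]
    rw [hQ]
    simp only [ContinuousLinearMap.coe_comp, Function.comp_apply, sub_apply, smul_apply, id_apply, inner_sub_left,
      adjoint_inner_left, Submodule.subtypeL_apply, inner_smul_left, hPa, hPx, Submodule.coe_inner]
  -- Here `α ≤ m(Q)`. Either `F` embeds `M` in its finite-dimensional range, or some nonzero `x ∈ M`
  -- has `F x = 0`; then `‖P x‖ = ‖(αI - K) x‖ ≤ α ‖x‖`, since `0 ≤ αI - K ≤ αI`.
  · by_cases hMF : LinearMap.ker ((F.comp M.subtypeL : M →L[ℂ] H) : M →ₗ[ℂ] H) = ⊥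
    · have : FiniteDimensional ℂ (LinearMap.range (F : H →ₗ[ℂ] H)) := hFf
      have hinj := LinearMap.ker_eq_bot.1 hMF
      have : FiniteDimensional ℂ M := by
        refine FiniteDimensional.of_injective
          (((F : H →ₗ[ℂ] H).rangeRestrict).comp M.subtype) fun x y hxy => hinj ?_
        exact congrArg Subtype.val hxy
      exact IsMinimumAttaining.of_finiteDimensional Q
    · obtain ⟨x, hx, hx0⟩ := Submodule.exists_mem_ne_zero_of_ne_bot hMF
      have hFx : F (x : H) = 0 := hx
      refine IsMinimumAttaining.of_norm_le hx0 ?_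
      have h1 : ‖(α : ℂ) • ContinuousLinearMap.id ℂ H - K‖ ≤ α := by
        refine norm_le_of_isPositive_of_isPositive_sub
          (isPositive_real_smul_id_sub hK.isSelfAdjoint hα) hα0 ?_
        rwa [sub_sub_cancel]
      have h2 : Q x = ((α : ℂ) • ContinuousLinearMap.id ℂ H - K) x := by
        rw [hQ, hP]; simp [hFx]
      rw [h2]
      calc _ ≤ ‖(α : ℂ) • ContinuousLinearMap.id ℂ H - K‖ * ‖(x : H)‖ := le_opNorm _ _
        _ ≤ minimumModulus Q * ‖x‖ := by
          rw [Submodule.coe_norm]; gcongr; exact h1.trans hge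

end Sufficiency

/-! ### Consequences of a decomposition, and its uniqueness -/

section Decomposition

variable {H₁ H₂ : Type*} [NormedAddCommGroup H₁] [InnerProductSpace ℂ H₁] [CompleteSpace H₁]
  [NormedAddCommGroup H₂] [InnerProductSpace ℂ H₂] [CompleteSpace H₂]
  {T V V' : H₁ →L[ℂ] H₂} {α α' : ℝ} {K K' F F' : H₁ →L[ℂ] H₁}

lemma IsSelfAdjoint.orthogonal_ker {P : H₁ →L[ℂ] H₁} (hP : IsSelfAdjoint P) :
    (LinearMap.ker (P : H₁ →ₗ[ℂ] H₁))ᗮ =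
      (LinearMap.range (P : H₁ →ₗ[ℂ] H₁)).topologicalClosure := by
  have h := ContinuousLinearMap.orthogonal_ker P
  rwa [hP.adjoint_eq] at h

lemma IsAMDecomposition.isPositive (h : IsAMDecomposition T V α K F) :
    ((α : ℂ) • ContinuousLinearMap.id ℂ H₁ - K + F).IsPositive :=
  (isPositive_real_smul_id_sub h.positive_compact.isSelfAdjoint h.norm_le).add
    h.positive_finiteRank

/-- As `αI - K + F` is self-adjoint with the same kernel as `V`, its range lies in `(ker V)ᗮ`, where
`V` is isometric. -/
lemma IsAMDecomposition.norm_apply (h : IsAMDecomposition T V α K F) (x : H₁) :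
    ‖T x‖ = ‖((α : ℂ) • ContinuousLinearMap.id ℂ H₁ - K + F) x‖ := by
  conv_lhs => rw [h.eq_comp]
  refine h.partialIsometry _ ?_
  rw [h.ker_eq, h.isPositive.isSelfAdjoint.orthogonal_ker]
  exact Submodule.le_topologicalClosure _ ⟨x, rfl⟩

/-- The quadratic forms of `P²` and `Q²` agree, hence so do these operators over `ℂ`; positive
square roots are unique. -/
lemma eq_of_isPositive_of_norm_apply_eq {P Q : H₁ →L[ℂ] H₁} (hP : P.IsPositive)
    (hQ : Q.IsPositive) (h : ∀ x, ‖P x‖ = ‖Q x‖) : P = Q := by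
  refine (CFC.mul_self_eq_mul_self_iff P Q ((nonneg_iff_isPositive P).2 hP)
    ((nonneg_iff_isPositive Q).2 hQ)).1 ?_
  have key : ∀ R : H₁ →L[ℂ] H₁, R.IsPositive → ∀ x, ⟪(R * R) x, x⟫_ℂ = (‖R x‖ : ℂ) ^ 2 :=
    fun R hR x => by
      change ⟪R (R x), x⟫_ℂ = _
      rw [hR.inner_left_eq_inner_right]
      exact inner_self_eq_norm_sq_to_K _
  refine coe_injective ((ext_inner_map _ _).1 fun x => ?_)
  have h1 := key P hP x
  rw [h x, ← key Q hQ x] at h1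
  exact h1

lemma IsAMDecomposition.unique (hH₁ : ¬ FiniteDimensional ℂ H₁) (h : IsAMDecomposition T V α K F)
    (h' : IsAMDecomposition T V' α' K' F') : V = V' ∧ α = α' ∧ K = K' ∧ F = F' := by
  have hP := eq_of_isPositive_of_norm_apply_eq h.isPositive h'.isPositive
    fun x => by rw [← h.norm_apply, ← h'.norm_apply]
  have hα : α = α' := by
    refine eq_of_compact_sub (A := K - F) (B := K' - F') hH₁ ?_ ?_ ?_
    · exact h.compact.sub h.finiteRank.isCompactOperator
    · exact h'.compact.sub h'.finiteRank.isCompactOperator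
    · rw [sub_sub_eq_add_sub, sub_sub_eq_add_sub, add_sub_right_comm, hP, add_sub_right_comm]
  subst hα
  have hFK : F - K = F' - K' := by
    rw [sub_add, sub_add] at hP
    rw [← neg_sub K F, ← neg_sub K' F', sub_right_injective hP]
  have hnn : ∀ {A : H₁ →L[ℂ] H₁}, A.IsPositive → 0 ≤ A := fun {A} hA =>
    (nonneg_iff_isPositive A).2 hA
  -- Since `F K = 0` with both positive, `F` and `K` are the positive and negative parts of `F - K`.
  obtain ⟨hF, hK⟩ := CFC.posPart_negPart_unique (a := F - K) rfl h.mul_zero_right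
    (hnn h.positive_finiteRank) (hnn h.positive_compact)
  obtain ⟨hF', hK'⟩ := CFC.posPart_negPart_unique hFK h'.mul_zero_right
    (hnn h'.positive_finiteRank) (hnn h'.positive_compact)
  refine ⟨?_, rfl, hK.symm.trans hK', hF.symm.trans hF'⟩
  set P := (α : ℂ) • ContinuousLinearMap.id ℂ H₁ - K + F with hPdef
  have hVP : V.comp P = V'.comp P := by
    rw [← h.eq_comp, hP]; exact h'.eq_comp
  have hker' : LinearMap.ker (V' : H₁ →ₗ[ℂ] H₂) = LinearMap.ker (P : H₁ →ₗ[ℂ] H₁) := by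
    rw [h'.ker_eq, ← hP]
  have hcl : LinearMap.ker (P : H₁ →ₗ[ℂ] H₁) ⊔ (LinearMap.ker (P : H₁ →ₗ[ℂ] H₁))ᗮ = ⊤ := by
    have : CompleteSpace (LinearMap.ker (P : H₁ →ₗ[ℂ] H₁)) := P.isClosed_ker.completeSpace_coe
    exact Submodule.sup_orthogonal_of_hasOrthogonalProjection
  -- Both partial isometries vanish on `ker P`, and they agree on the range of `P`, which is dense
  -- in `(ker P)ᗮ`.
  have hle : LinearMap.ker (P : H₁ →ₗ[ℂ] H₁) ⊔ (LinearMap.ker (P : H₁ →ₗ[ℂ] H₁))ᗮ ≤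
      LinearMap.ker ((V - V' : H₁ →L[ℂ] H₂) : H₁ →ₗ[ℂ] H₂) := by
    refine sup_le (fun x hx => ?_) ?_
    · have h1 : V x = 0 := (h.ker_eq.symm ▸ hx : x ∈ LinearMap.ker (V : H₁ →ₗ[ℂ] H₂))
      have h2 : V' x = 0 := (hker'.symm ▸ hx : x ∈ LinearMap.ker (V' : H₁ →ₗ[ℂ] H₂))
      simp [h1, h2]
    · rw [h.isPositive.isSelfAdjoint.orthogonal_ker]
      refine Submodule.topologicalClosure_minimal _ ?_ (V - V').isClosed_ker
      rintro _ ⟨x, rfl⟩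
      exact sub_eq_zero.2 (DFunLike.congr_fun hVP x)
  rw [hcl] at hle
  ext x
  simpa [sub_eq_zero] using hle (Submodule.mem_top (x := x))

lemma IsAMDecomposition.isAbsolutelyMinimumAttaining (h : IsAMDecomposition T V α K F) :
    IsAbsolutelyMinimumAttaining T :=
  (isAbsolutelyMinimumAttaining_of_compact_finiteRank h.compact h.positive_compact h.norm_le
    h.finiteRank h.positive_finiteRank).congr_norm h.norm_apply

end Decomposition

/-! ### Spectral structure of absolutely minimum attaining operators -/

section Necessity

lemma exists_combination_norm_apply_eq {E : Type*} [NormedAddCommGroup E]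
    [InnerProductSpace ℂ E] {S : E →L[ℂ] E} {u v : E} {s r t : ℝ} (hu : ‖u‖ = 1)
    (hv : ‖v‖ = 1) (huv : ⟪u, v⟫_ℂ = 0) (hSu : S u = (s : ℂ) • u) (hSv : S v = (r : ℂ) • v)
    (hs : 0 ≤ s) (hst : s < t) (htr : t < r) :
    ∃ c d : ℂ, ‖c • u + d • v‖ = 1 ∧ ‖S (c • u + d • v)‖ = t := by
  have hgen : ∀ c d : ℂ, ‖c • u + d • v‖ ^ 2 = ‖c‖ ^ 2 + ‖d‖ ^ 2 := fun c d => by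
    have h : ⟪c • u, d • v⟫_ℂ = 0 := by
      rw [inner_smul_left, inner_smul_right, huv, mul_zero, mul_zero]
    rw [sq, norm_add_sq_eq_norm_sq_add_norm_sq_of_inner_eq_zero _ _ h, norm_smul, norm_smul, hu, hv]
    ring
  have hden : 0 < r ^ 2 - s ^ 2 := by nlinarith
  have hp0 : 0 ≤ (r ^ 2 - t ^ 2) / (r ^ 2 - s ^ 2) := div_nonneg (by nlinarith) hden.le
  have hq0 : 0 ≤ (t ^ 2 - s ^ 2) / (r ^ 2 - s ^ 2) := div_nonneg (by nlinarith) hden.le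
  -- Solution of `c² + d² = 1`, `c² s² + d² r² = t²`.
  refine ⟨(√((r ^ 2 - t ^ 2) / (r ^ 2 - s ^ 2)) : ℝ), (√((t ^ 2 - s ^ 2) / (r ^ 2 - s ^ 2)) : ℝ),
    ?_, ?_⟩
  · refine (sq_eq_sq₀ (norm_nonneg _) zero_le_one).1 ?_
    rw [hgen, Complex.norm_real, Complex.norm_real, Real.norm_eq_abs, Real.norm_eq_abs, sq_abs,
      sq_abs, Real.sq_sqrt hp0, Real.sq_sqrt hq0]
    field_simp
    ring
  · refine (sq_eq_sq₀ (norm_nonneg _) (by linarith)).1 ?_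
    rw [map_add, map_smul, map_smul, hSu, hSv, smul_smul, smul_smul, hgen, norm_mul, norm_mul,
      Complex.norm_real, Complex.norm_real, Complex.norm_real, Complex.norm_real, mul_pow, mul_pow]
    simp only [Real.norm_eq_abs, sq_abs]
    rw [Real.sq_sqrt hp0, Real.sq_sqrt hq0]
    field_simp
    ring

variable {H G : Type*} [NormedAddCommGroup H] [InnerProductSpace ℂ H] [CompleteSpace H]
  [NormedAddCommGroup G] [InnerProductSpace ℂ G] [CompleteSpace G]

/-- With `Q = T|_M`, the positive operator `Q*Q - m²` has vanishing form at the minimizer, so it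
kills it. The last clause is this Euler–Lagrange equation, tested against `M` only. -/
lemma IsAbsolutelyMinimumAttaining.exists_minimizer {T : H →L[ℂ] G}
    (hT : IsAbsolutelyMinimumAttaining T) {M : Submodule ℂ H} (hM : IsClosed (M : Set H))
    (hM0 : M ≠ ⊥) : ∃ x ∈ M, ∃ m : ℝ, 0 ≤ m ∧ ‖x‖ = 1 ∧ ‖T x‖ = m ∧ (∀ y ∈ M, m * ‖y‖ ≤ ‖T y‖) ∧
      ∀ y ∈ M, ⟪T x, T y⟫_ℂ = ((m ^ 2 : ℝ) : ℂ) * ⟪x, y⟫_ℂ := by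
  obtain ⟨x, hx, hmin⟩ := hT M hM hM0
  have : CompleteSpace M := hM.completeSpace_coe
  set Q := T.comp M.subtypeL with hQ
  have hm0 := minimumModulus_nonneg Q
  have hle := minimumModulus_mul_norm_le Q
  set m := minimumModulus Q
  obtain ⟨c, hc, hcle⟩ := (isPositive_adjoint_comp_self_sub Q hm0 hle).exists_norm_sq_apply_le
  have h1 := hcle x
  rw [re_inner_adjoint_comp_self_sub, hmin, hx, one_pow, mul_one, sub_self, mul_zero] at h1
  have h2 := norm_eq_zero.1 (pow_eq_zero_iff two_ne_zero |>.1 (le_antisymm h1 (sq_nonneg _)))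
  refine ⟨x, x.2, m, hm0, by simpa using hx, hmin, fun y hy => hle ⟨y, hy⟩, fun y hy => ?_⟩
  have h3 : ⟪((adjoint Q).comp Q - ((m ^ 2 : ℝ) : ℂ) • ContinuousLinearMap.id ℂ M) x,
      (⟨y, hy⟩ : M)⟫_ℂ = 0 := by rw [h2, inner_zero_left]
  simp only [sub_apply, smul_apply, ContinuousLinearMap.coe_comp, Function.comp_apply, id_apply,
    inner_sub_left, adjoint_inner_left, inner_smul_left, Complex.conj_ofReal] at h3
  exact sub_eq_zero.1 h3

/-- On the closed span of the `u n`, `T*T` acts weakly as the diagonal with entries `‖T (u n)‖²`,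
all strictly above `m²`. Comparison with the Euler–Lagrange equation makes the minimizer orthogonal
to every `u n`, hence zero. -/
lemma IsAbsolutelyMinimumAttaining.not_strictAnti {T : H →L[ℂ] G}
    (hT : IsAbsolutelyMinimumAttaining T) {u : ℕ → H} (hu : Orthonormal ℂ u)
    (hTu : Pairwise fun i j => ⟪T (u i), T (u j)⟫_ℂ = 0) : ¬ StrictAnti fun n => ‖T (u n)‖ := by
  intro hanti
  set M := (Submodule.span ℂ (Set.range u)).topologicalClosure with hM
  have huM : ∀ n, u n ∈ M := fun n =>
    Submodule.le_topologicalClosure _ (Submodule.subset_span ⟨n, rfl⟩)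
  have hM0 : M ≠ ⊥ := fun h => hu.ne_zero 0 (by simpa [h] using huM 0)
  obtain ⟨x, hxM, m, hm0, hx, -, hle, hcrit⟩ :=
    hT.exists_minimizer (Submodule.isClosed_topologicalClosure _) hM0
  -- Strictness comes from passing to the next index: `m ≤ ‖T (u (n + 1))‖ < ‖T (u n)‖`.
  have hmlt : ∀ n, m < ‖T (u n)‖ := fun n => by
    have := hle _ (huM (n + 1))
    rw [hu.norm_eq_one, mul_one] at this
    exact this.trans_lt (hanti (Nat.lt_succ_self n))
  have horth : ∀ n, ∀ y ∈ M, ⟪T (u n), T y⟫_ℂ = ((‖T (u n)‖ ^ 2 : ℝ) : ℂ) * ⟪u n, y⟫_ℂ := by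
    intro n
    have hsub : M ≤ LinearMap.ker (((innerSL ℂ (T (u n))).comp T -
        ((‖T (u n)‖ ^ 2 : ℝ) : ℂ) • innerSL ℂ (u n) : H →L[ℂ] ℂ) : H →ₗ[ℂ] ℂ) := by
      refine Submodule.topologicalClosure_minimal _ (Submodule.span_le.2 ?_)
        (ContinuousLinearMap.isClosed_ker _)
      rintro _ ⟨k, rfl⟩
      change ⟪T (u n), T (u k)⟫_ℂ - ((‖T (u n)‖ ^ 2 : ℝ) : ℂ) * ⟪u n, u k⟫_ℂ = 0
      rcases eq_or_ne n k with rfl | hnk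
      · rw [inner_self_eq_norm_sq_to_K, inner_self_eq_norm_sq_to_K, hu.norm_eq_one]
        simp
      · rw [hTu hnk, hu.2 hnk]; simp
    exact fun y hy => sub_eq_zero.1 (hsub hy)
  have hxu : ∀ n, ⟪u n, x⟫_ℂ = 0 := fun n => by
    have h1 := horth n x hxM
    have h2 := congrArg (starRingEnd ℂ) (hcrit _ (huM n))
    rw [inner_conj_symm, map_mul, inner_conj_symm, Complex.conj_ofReal, h1] at h2
    rw [← sub_eq_zero, ← sub_mul, ← Complex.ofReal_sub] at h2
    refine (mul_eq_zero.1 h2).resolve_left ?_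
    rw [Complex.ofReal_eq_zero, sub_eq_zero]
    exact (pow_lt_pow_left₀ (hmlt n) hm0 two_ne_zero).ne'
  have hMx : M ≤ LinearMap.ker (innerSL ℂ x : H →ₗ[ℂ] ℂ) := by
    refine Submodule.topologicalClosure_minimal _ (Submodule.span_le.2 ?_)
      (ContinuousLinearMap.isClosed_ker _)
    rintro _ ⟨k, rfl⟩
    exact inner_eq_zero_symm.1 (hxu k)
  have h0 : x = 0 := inner_self_eq_zero (𝕜 := ℂ) |>.1 (hMx hxM)
  simp [h0] at hx

/-- Invariance upgrades the Euler–Lagrange equation to `S² x = m² x`. Then `y = S x - m x` satisfies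
`S y = -m y`, which positivity excludes for `m > 0` unless `y = 0`. -/
lemma IsAbsolutelyMinimumAttaining.exists_eigenvector {S : H →L[ℂ] H} (hS : S.IsPositive)
    (hAM : IsAbsolutelyMinimumAttaining S) {M : Submodule ℂ H} (hM : IsClosed (M : Set H))
    (hM0 : M ≠ ⊥) (hinv : ∀ x ∈ M, S x ∈ M) :
    ∃ x ∈ M, ∃ m : ℝ, ‖x‖ = 1 ∧ 0 ≤ m ∧ S x = (m : ℂ) • x := by
  obtain ⟨x, hxM, m, hm0, hx, hSx, -, hcrit⟩ := hAM.exists_minimizer hM hM0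
  refine ⟨x, hxM, m, hx, hm0, ?_⟩
  have hSS : S (S x) = ((m ^ 2 : ℝ) : ℂ) • x := by
    have hmem : S (S x) - ((m ^ 2 : ℝ) : ℂ) • x ∈ M :=
      M.sub_mem (hinv _ (hinv _ hxM)) (M.smul_mem _ hxM)
    refine sub_eq_zero.1 (inner_self_eq_zero (𝕜 := ℂ) |>.1 ?_)
    set y := S (S x) - ((m ^ 2 : ℝ) : ℂ) • x with hy
    conv_lhs => enter [2]; rw [hy]
    rw [inner_sub_left, hS.inner_left_eq_inner_right, hcrit y hmem, inner_smul_left,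
      Complex.conj_ofReal, sub_self]
  rcases hm0.eq_or_lt with h0 | hpos
  · rw [← h0] at hSx ⊢
    simpa using hSx
  · set y := S x - (m : ℂ) • x with hy
    have hSy : S y = -((m : ℂ) • y) := by
      rw [hy, map_sub, map_smul, hSS]
      push_cast
      module
    have h1 := hS.re_inner_nonneg_left y
    have h2 : RCLike.re ⟪S y, y⟫_ℂ = -(m * ‖y‖ ^ 2) := by
      rw [hSy, inner_neg_left, inner_smul_left, Complex.conj_ofReal, inner_self_eq_norm_sq_to_K]
      change (-((m : ℂ) * (‖y‖ : ℂ) ^ 2)).re = _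
      rw [← Complex.ofReal_pow, ← Complex.ofReal_mul, ← Complex.ofReal_neg, Complex.ofReal_re]
    rw [h2] at h1
    have h3 : ‖y‖ ^ 2 = 0 := by nlinarith [sq_nonneg ‖y‖]
    exact sub_eq_zero.1 (norm_eq_zero.1 (pow_eq_zero_iff two_ne_zero |>.1 h3))

lemma IsAbsolutelyMinimumAttaining.exists_hilbertBasis {S : H →L[ℂ] H} (hS : S.IsPositive)
    (hAM : IsAbsolutelyMinimumAttaining S) :
    ∃ (w : Set H) (e : HilbertBasis w ℂ H) (μ : w → ℝ),
      (∀ i, 0 ≤ μ i) ∧ ∀ i, S (e i) = (μ i : ℂ) • e i := by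
  obtain ⟨w, -, hw⟩ := zorn_subset_nonempty {b : Set H | Orthonormal ℂ (Subtype.val : b → H) ∧
      ∀ x ∈ b, ∃ m : ℝ, 0 ≤ m ∧ S x = (m : ℂ) • x} (by
    refine fun c hc cc _ => ⟨⋃₀ c, ⟨?_, ?_⟩, fun _ => Set.subset_sUnion_of_mem⟩
    · exact orthonormal_sUnion_of_directed cc.directedOn fun x xc => (hc xc).1
    · rintro x ⟨b, hb, hxb⟩
      exact (hc hb).2 x hxb) ∅ (by simp)
  obtain ⟨⟨hon, heig⟩, hmax⟩ := hw
  -- The complement of a span of eigenvectors is invariant, so if nonzero it would contain a further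
  -- unit eigenvector, against maximality.
  have hbot : (Submodule.span ℂ (Set.range (Subtype.val : w → H)))ᗮ = ⊥ := by
    by_contra hne
    obtain ⟨x, hx, m, hx1, hm, hSx⟩ := hAM.exists_eigenvector hS
      (Submodule.isClosed_orthogonal _) hne (by
        intro x hx
        rw [Submodule.mem_orthogonal] at hx ⊢
        intro u hu
        rw [← hS.inner_left_eq_inner_right]
        refine hx _ ?_
        refine (Submodule.span_le (p := (Submodule.span ℂ
          (Set.range (Subtype.val : w → H))).comap (S : H →ₗ[ℂ] H))).2 ?_ hu
        rintro _ ⟨i, rfl⟩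
        obtain ⟨k, -, hk⟩ := heig i i.2
        rw [SetLike.mem_coe, Submodule.mem_comap, ContinuousLinearMap.coe_coe, hk]
        exact Submodule.smul_mem _ _ (Submodule.subset_span ⟨i, rfl⟩))
    have hxw : ∀ y ∈ w, ⟪y, x⟫_ℂ = 0 := fun y hy =>
      (Submodule.mem_orthogonal _ _).1 hx y (Submodule.subset_span ⟨⟨y, hy⟩, rfl⟩)
    have hins : insert x w ≤ w := by
      refine hmax (y := insert x w) ⟨?_, ?_⟩ (Set.subset_insert x w)
      · constructor
        · rintro ⟨y, rfl | hy⟩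
          · exact hx1
          · exact hon.1 ⟨y, hy⟩
        · rintro ⟨y, hy⟩ ⟨z, hz⟩ hyz
          rw [Ne, Subtype.mk.injEq] at hyz
          change ⟪y, z⟫_ℂ = 0
          rcases hy with rfl | hy <;> rcases hz with rfl | hz
          · exact absurd rfl hyz
          · exact inner_eq_zero_symm.1 (hxw z hz)
          · exact hxw y hy
          · exact hon.2 (i := ⟨y, hy⟩) (j := ⟨z, hz⟩) (by simpa using hyz)
      · rintro y (rfl | hy)
        · exact ⟨m, hm, hSx⟩
        · exact heig y hy
    have h0 := hxw x (hins (Set.mem_insert x w))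
    rw [inner_self_eq_zero] at h0
    simp [h0] at hx1
  choose μ hμ0 hμ using fun i : w => heig i i.2
  exact ⟨w, HilbertBasis.mkOfOrthogonalEqBot hon hbot, μ, hμ0, by simpa using hμ⟩

variable {ι : Type*}

lemma IsAbsolutelyMinimumAttaining.wellFounded_eigenvalues {S : H →L[ℂ] H}
    (hAM : IsAbsolutelyMinimumAttaining S) (e : HilbertBasis ι ℂ H) {μ : ι → ℝ}
    (hμ0 : ∀ i, 0 ≤ μ i) (hμ : ∀ i, S (e i) = (μ i : ℂ) • e i) :
    WellFounded fun i j => μ i < μ j := by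
  refine wellFounded_iff_isEmpty_descending_chain.2 ⟨fun ⟨f, hf⟩ => ?_⟩
  have hanti : StrictAnti (μ ∘ f) := strictAnti_nat_of_succ_lt hf
  have hinj : Function.Injective f := hanti.injective.of_comp
  refine hAM.not_strictAnti (e.orthonormal.comp f hinj) (fun i j hij => ?_) ?_
  · simp only [Function.comp_apply, hμ, inner_smul_left, inner_smul_right,
      e.orthonormal.2 (hinj.ne hij), mul_zero]
  · convert hanti using 2 with n
    simp only [Function.comp_apply, hμ, norm_smul, e.orthonormal.1, mul_one, Complex.norm_real,
      Real.norm_of_nonneg (hμ0 _)]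

/-- Otherwise, pairing eigenvectors at levels `≤ a` and `≥ b` gives unit combinations with any
prescribed image norm in `(a, b)`. Disjoint pairs stay orthogonal, also after `S`, so a strictly
decreasing choice contradicts `not_strictAnti`. -/
lemma IsAbsolutelyMinimumAttaining.finite_or_finite {S : H →L[ℂ] H}
    (hAM : IsAbsolutelyMinimumAttaining S) (e : HilbertBasis ι ℂ H) {μ : ι → ℝ}
    (hμ0 : ∀ i, 0 ≤ μ i) (hμ : ∀ i, S (e i) = (μ i : ℂ) • e i) {a b : ℝ} (hab : a < b) :
    {i | μ i ≤ a}.Finite ∨ {i | b ≤ μ i}.Finite := by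
  by_contra! hcon
  obtain ⟨h1, h2⟩ := hcon
  set f := Set.Infinite.natEmbedding _ h1
  set g := Set.Infinite.natEmbedding _ h2
  have hfg : ∀ m n, (f m : ι) ≠ g n := fun m n h => by
    have h3 : μ (f m) ≤ a := (f m).2
    have h4 : b ≤ μ (g n) := (g n).2
    rw [h] at h3
    linarith
  -- The shift by `2` keeps `t 0` strictly below `b`.
  set t : ℕ → ℝ := fun n => a + (b - a) / (n + 2) with ht
  have htanti : StrictAnti t := fun m n hmn => by
    have : (m : ℝ) < n := by exact_mod_cast hmn
    have : 0 < b - a := by linarith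
    simp only [ht]
    gcongr
  have hta : ∀ n, a < t n := fun n => by
    have : 0 < (b - a) / (n + 2) := div_pos (by linarith) (by positivity)
    simp only [ht]; linarith
  have htb : ∀ n, t n < b := fun n => by
    have : (b - a) / (n + 2) < b - a := div_lt_self (by linarith)
      (by linarith [n.cast_nonneg (α := ℝ)])
    simp only [ht]; linarith
  have hex := fun n : ℕ => exists_combination_norm_apply_eq (e.orthonormal.1 (f n))
    (e.orthonormal.1 (g n)) (e.orthonormal.2 (hfg n n)) (hμ _) (hμ _) (hμ0 _)
    (lt_of_le_of_lt (f n).2 (hta n)) (lt_of_lt_of_le (htb n) (g n).2)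
  choose c d hnorm hSnorm using hex
  have hff : ∀ {m n}, m ≠ n → ⟪e (f m), e (f n)⟫_ℂ = 0 := fun h =>
    e.orthonormal.2 (Subtype.val_injective.ne (f.injective.ne h))
  have hgg : ∀ {m n}, m ≠ n → ⟪e (g m), e (g n)⟫_ℂ = 0 := fun h =>
    e.orthonormal.2 (Subtype.val_injective.ne (g.injective.ne h))
  have hfg' : ∀ m n, ⟪e (f m), e (g n)⟫_ℂ = 0 := fun m n => e.orthonormal.2 (hfg m n)
  have hgf : ∀ m n, ⟪e (g m), e (f n)⟫_ℂ = 0 := fun m n => e.orthonormal.2 (hfg n m).symm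
  refine hAM.not_strictAnti (u := fun n => c n • e (f n) + d n • e (g n)) ⟨hnorm, ?_⟩ ?_ ?_
  · intro m n hmn
    simp only [inner_add_left, inner_add_right, inner_smul_left, inner_smul_right, hff hmn,
      hgg hmn, hfg', hgf, mul_zero, add_zero]
  · intro m n hmn
    simp only [map_add, map_smul, hμ, inner_add_left, inner_add_right, inner_smul_left,
      inner_smul_right, hff hmn, hgg hmn, hfg', hgf, mul_zero, add_zero]
  · simpa only [hSnorm] using htanti

lemma IsAbsolutelyMinimumAttaining.exists_accumulation {S : H →L[ℂ] H}
    (hH : ¬ FiniteDimensional ℂ H)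
    (hAM : IsAbsolutelyMinimumAttaining S) (e : HilbertBasis ι ℂ H) {μ : ι → ℝ}
    (hμ0 : ∀ i, 0 ≤ μ i) (hμ : ∀ i, S (e i) = (μ i : ℂ) • e i) :
    ∃ α : ℝ, 0 ≤ α ∧ {i | α < μ i}.Finite ∧ ∀ ε > 0, {i | μ i < α - ε}.Finite := by
  have hι : Infinite ι := by
    by_contra hfin
    rw [not_infinite_iff_finite] at hfin
    have hd := e.dense_span
    have : FiniteDimensional ℂ (Submodule.span ℂ (Set.range e)) :=
      FiniteDimensional.span_of_finite ℂ (Set.finite_range e)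
    rw [(Submodule.closed_of_finiteDimensional _).submodule_topologicalClosure_eq] at hd
    rw [hd] at this
    exact hH (Submodule.topEquiv.finiteDimensional)
  -- `α` is the infimum of the levels with infinitely many eigenvalues below them.
  set A : Set ℝ := {t | {i | μ i < t}.Infinite} with hA
  have hAne : A.Nonempty := by
    refine ⟨‖S‖ + 1, ?_⟩
    have : {i | μ i < ‖S‖ + 1} = Set.univ := Set.eq_univ_of_forall fun i => by
      have h := S.le_opNorm (e i)
      rw [hμ, norm_smul, e.orthonormal.1, mul_one, mul_one, Complex.norm_real,
        Real.norm_of_nonneg (hμ0 i)] at h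
      exact lt_of_le_of_lt h (lt_add_one _)
    rw [hA, Set.mem_ofPred_eq, this]
    exact Set.infinite_univ
  have hA0 : ∀ t ∈ A, 0 ≤ t := fun t ht => by
    obtain ⟨i, hi⟩ := Set.Infinite.nonempty ht
    exact (hμ0 i).trans (le_of_lt hi)
  refine ⟨sInf A, le_csInf hAne hA0, ?_, fun ε hε => ?_⟩
  · by_contra hinf
    -- Take the least eigenvalue `μ i` above `α`; no eigenvalue lies strictly between. By
    -- `finite_or_finite`, either those `≤ α` are finitely many, contradicting some `t ∈ A` with `t
    -- < μ i`, or those `≥ μ i` are, which are all those above `α`.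
    obtain ⟨i, hi, himin⟩ := (hAM.wellFounded_eigenvalues e hμ0 hμ).has_min _
      (Set.Infinite.nonempty hinf)
    have hi' : sInf A < μ i := hi
    have hmin : ∀ j, sInf A < μ j → μ i ≤ μ j := fun j hj => not_lt.1 (himin j hj)
    rcases hAM.finite_or_finite e hμ0 hμ hi' with h | h
    · obtain ⟨t, htA, hti⟩ := exists_lt_of_csInf_lt hAne hi'
      refine htA (h.subset fun j hj => ?_)
      by_contra hj'
      have h1 := hmin j (not_le.1 hj')
      have h2 : μ j < t := hj
      linarith
    · exact hinf (h.subset hmin)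
  · by_contra hinf
    have := csInf_le ⟨0, hA0⟩ (show sInf A - ε ∈ A from hinf)
    linarith

end Necessity

/-! ### Diagonal operators and the construction of `K` and `F` -/

section Diagonal

variable {H ι : Type*} [NormedAddCommGroup H] [InnerProductSpace ℂ H]

lemma HilbertBasis.clm_ext {G : Type*} [NormedAddCommGroup G] [InnerProductSpace ℂ G]
    (e : HilbertBasis ι ℂ H) {A B : H →L[ℂ] G} (h : ∀ i, A (e i) = B (e i)) : A = B := by
  refine ContinuousLinearMap.ext_on
    (Submodule.dense_iff_topologicalClosure_eq_top.2 e.dense_span) ?_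
  rintro _ ⟨i, rfl⟩
  exact h i

/-- The finite diagonal operator `∑ i ∈ s, c i ⟪e i, ·⟫ e i`. -/
noncomputable def HilbertBasis.diagonalSum (e : HilbertBasis ι ℂ H) (s : Finset ι) (c : ι → ℝ) :
    H →L[ℂ] H :=
  ∑ i ∈ s, (c i : ℂ) • InnerProductSpace.rankOne ℂ (e i) (e i)

lemma HilbertBasis.diagonalSum_apply [DecidableEq ι] (e : HilbertBasis ι ℂ H) (s : Finset ι)
    (c : ι → ℝ) (j : ι) :
    e.diagonalSum s c (e j) = ((if j ∈ s then c j else 0 : ℝ) : ℂ) • e j := by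
  simp only [HilbertBasis.diagonalSum, sum_apply, smul_apply, InnerProductSpace.rankOne_apply,
    orthonormal_iff_ite.1 e.orthonormal, ite_smul, one_smul, zero_smul, smul_ite, smul_zero,
    Finset.sum_ite_eq', apply_ite Complex.ofReal, Complex.ofReal_zero]

lemma HilbertBasis.isFiniteRankOperator_diagonalSum (e : HilbertBasis ι ℂ H) (s : Finset ι)
    (c : ι → ℝ) : IsFiniteRankOperator (e.diagonalSum s c) := by
  have : FiniteDimensional ℂ (Submodule.span ℂ (e '' (s : Set ι))) :=
    FiniteDimensional.span_of_finite ℂ (s.finite_toSet.image e)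
  refine Submodule.finiteDimensional_of_le (S₂ := Submodule.span ℂ (e '' (s : Set ι))) ?_
  rintro _ ⟨x, rfl⟩
  change e.diagonalSum s c x ∈ _
  simp only [HilbertBasis.diagonalSum, sum_apply, smul_apply, InnerProductSpace.rankOne_apply]
  exact Submodule.sum_mem _ fun i hi => Submodule.smul_mem _ _ (Submodule.smul_mem _ _
    (Submodule.subset_span ⟨i, hi, rfl⟩))

variable [CompleteSpace H]

lemma HilbertBasis.isSelfAdjoint_diagonalSum (e : HilbertBasis ι ℂ H) (s : Finset ι)
    (c : ι → ℝ) : IsSelfAdjoint (e.diagonalSum s c) :=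
  isSelfAdjoint_sum _ fun i _ =>
    IsSelfAdjoint.smul (Complex.conj_ofReal _)
      (InnerProductSpace.isPositive_rankOne_self (e i)).isSelfAdjoint

/-- By Parseval, `⟪A x, x⟫ = ∑ κ i |⟪e i, x⟫|²`. -/
lemma HilbertBasis.isPositive_of_eigenvalues_nonneg (e : HilbertBasis ι ℂ H) {A : H →L[ℂ] H}
    (hA : IsSelfAdjoint A) {κ : ι → ℝ} (hκ : ∀ i, A (e i) = (κ i : ℂ) • e i) (h0 : ∀ i, 0 ≤ κ i) :
    A.IsPositive := by
  refine isPositive_of_re_inner_nonneg hA fun x => ?_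
  have h1 := Complex.hasSum_re (e.hasSum_inner_mul_inner (A x) x)
  refine h1.nonneg fun i => ?_
  have h2 : ⟪A x, e i⟫_ℂ = κ i * ⟪x, e i⟫_ℂ := by
    rw [← adjoint_inner_right, hA.adjoint_eq, hκ, inner_smul_right]
  rw [h2, mul_assoc, Complex.re_ofReal_mul]
  refine mul_nonneg (h0 i) ?_
  rw [← inner_conj_symm x (e i), mul_comm, Complex.mul_conj, Complex.ofReal_re]
  exact Complex.normSq_nonneg _

lemma HilbertBasis.norm_le_of_eigenvalues (e : HilbertBasis ι ℂ H) {A : H →L[ℂ] H}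
    (hA : IsSelfAdjoint A) {κ : ι → ℝ} (hκ : ∀ i, A (e i) = (κ i : ℂ) • e i) (h0 : ∀ i, 0 ≤ κ i)
    {c : ℝ} (hc0 : 0 ≤ c) (hc : ∀ i, κ i ≤ c) : ‖A‖ ≤ c := by
  refine norm_le_of_isPositive_of_isPositive_sub (e.isPositive_of_eigenvalues_nonneg hA hκ h0) hc0
    (e.isPositive_of_eigenvalues_nonneg (κ := fun i => c - κ i)
      ((isSelfAdjoint_real_smul_id c).sub hA) (fun i => ?_) fun i => sub_nonneg.2 (hc i))
  simp [hκ, sub_smul]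

/-- Keeping only the finitely many eigenvalues above `ε` gives a finite rank operator within `ε` of
`A`; compact operators are norm closed. -/
lemma HilbertBasis.isCompactOperator_of_eigenvalues (e : HilbertBasis ι ℂ H) {A : H →L[ℂ] H}
    (hA : IsSelfAdjoint A) {κ : ι → ℝ} (hκ : ∀ i, A (e i) = (κ i : ℂ) • e i) (h0 : ∀ i, 0 ≤ κ i)
    (hfin : ∀ ε > 0, {i | ε < κ i}.Finite) : IsCompactOperator A := by
  classical
  have happrox : ∀ ε > 0, ∃ B : H →L[ℂ] H, IsCompactOperator B ∧ ‖A - B‖ ≤ ε := by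
    intro ε hε
    refine ⟨e.diagonalSum (hfin ε hε).toFinset κ,
      (e.isFiniteRankOperator_diagonalSum _ _).isCompactOperator, ?_⟩
    refine e.norm_le_of_eigenvalues (κ := fun i => if ε < κ i then 0 else κ i)
      (hA.sub (e.isSelfAdjoint_diagonalSum _ _)) (fun i => ?_) (fun i => ?_) hε.le fun i => ?_
    · rw [sub_apply, hκ, e.diagonalSum_apply, ← sub_smul, ← Complex.ofReal_sub]
      congr 2
      by_cases h : ε < κ i <;> simp [h]
    · split_ifs
      exacts [le_rfl, h0 i]
    · split_ifs with h
      exacts [hε.le, not_lt.1 h]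
  have hcl : A ∈ closure {B : H →L[ℂ] H | IsCompactOperator B} := by
    refine Metric.mem_closure_iff.2 fun ε hε => ?_
    obtain ⟨B, hB, hAB⟩ := happrox (ε / 2) (half_pos hε)
    exact ⟨B, hB, by rw [dist_eq_norm]; linarith⟩
  rwa [isClosed_setOfPred_isCompactOperator.closure_eq] at hcl

lemma IsAbsolutelyMinimumAttaining.exists_compact_finiteRank {S : H →L[ℂ] H}
    (hH : ¬ FiniteDimensional ℂ H) (hS : S.IsPositive) (hAM : IsAbsolutelyMinimumAttaining S) :
    ∃ (α : ℝ) (K F : H →L[ℂ] H), IsCompactOperator K ∧ K.IsPositive ∧ ‖K‖ ≤ α ∧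
      IsFiniteRankOperator F ∧ F.IsPositive ∧ K.comp F = 0 ∧ F.comp K = 0 ∧
      S = (α : ℂ) • ContinuousLinearMap.id ℂ H - K + F := by
  classical
  obtain ⟨w, e, μ, hμ0, hμ⟩ := hAM.exists_hilbertBasis hS
  obtain ⟨α, hα0, hfin, hfin'⟩ := hAM.exists_accumulation hH e hμ0 hμ
  set F := e.diagonalSum hfin.toFinset (fun i => μ i - α) with hF
  -- Only `F` is built as a finite sum; solving the required identity for `K` avoids constructing an
  -- infinite diagonal operator.
  set K := (α : ℂ) • ContinuousLinearMap.id ℂ H - S + F with hK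
  have hFs : IsSelfAdjoint F := e.isSelfAdjoint_diagonalSum _ _
  have hKs : IsSelfAdjoint K := ((isSelfAdjoint_real_smul_id α).sub hS.isSelfAdjoint).add hFs
  have hFe : ∀ i, F (e i) = ((max (μ i - α) 0 : ℝ) : ℂ) • e i := fun i => by
    rw [hF, e.diagonalSum_apply]
    congr 2
    by_cases h : α < μ i
    · simp [h, h.le]
    · simp [h, not_lt.1 h]
  have hKe : ∀ i, K (e i) = ((max (α - μ i) 0 : ℝ) : ℂ) • e i := fun i => by
    rw [hK, add_apply, sub_apply, smul_apply, id_apply, hμ, hFe, ← sub_smul, ← add_smul,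
      ← Complex.ofReal_sub, ← Complex.ofReal_add]
    congr 2
    rcases le_total α (μ i) with h | h
    · rw [max_eq_left (sub_nonneg.2 h), max_eq_right (sub_nonpos.2 h)]; ring
    · rw [max_eq_right (sub_nonpos.2 h), max_eq_left (sub_nonneg.2 h)]; ring
  have hmul : ∀ i, max (μ i - α) 0 * max (α - μ i) 0 = 0 := fun i => by
    rcases le_total α (μ i) with h | h
    · rw [max_eq_right (sub_nonpos.2 h), mul_zero]
    · rw [max_eq_right (sub_nonpos.2 h), zero_mul]
  refine ⟨α, K, F, ?_, ?_, ?_, e.isFiniteRankOperator_diagonalSum _ _, ?_, ?_, ?_, ?_⟩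
  · refine e.isCompactOperator_of_eigenvalues hKs hKe (fun i => le_max_right _ _) fun ε hε => ?_
    refine (hfin' ε hε).subset fun i hi => ?_
    have h1 : ε < α - μ i := (lt_max_iff.1 hi).resolve_right hε.le.not_gt
    change μ i < α - ε
    linarith
  · exact e.isPositive_of_eigenvalues_nonneg hKs hKe fun i => le_max_right _ _
  · exact e.norm_le_of_eigenvalues hKs hKe (fun i => le_max_right _ _) hα0
      fun i => max_le (sub_le_self _ (hμ0 i)) hα0
  · exact e.isPositive_of_eigenvalues_nonneg hFs hFe fun i => le_max_right _ _
  · refine e.clm_ext fun i => ?_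
    rw [comp_apply, hFe, map_smul, hKe, smul_smul, ← Complex.ofReal_mul, hmul]
    simp
  · refine e.clm_ext fun i => ?_
    rw [comp_apply, hKe, map_smul, hFe, smul_smul, ← Complex.ofReal_mul, mul_comm, hmul]
    simp
  · rw [hK]; abel

end Diagonal

/-! ### Polar decomposition and conclusion -/

section Polar

variable {H₁ H₂ : Type*} [NormedAddCommGroup H₁] [InnerProductSpace ℂ H₁] [CompleteSpace H₁]
  [NormedAddCommGroup H₂] [InnerProductSpace ℂ H₂] [CompleteSpace H₂]

/-- The map `S x ↦ T x` is isometric, so it extends to the closure of the range of `S`, which is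
`(ker S)ᗮ`. Precomposing with the projection onto it gives `V`. -/
lemma exists_partialIsometry_comp_eq {S : H₁ →L[ℂ] H₁} (hS : IsSelfAdjoint S) {T : H₁ →L[ℂ] H₂}
    (h : ∀ x, ‖T x‖ = ‖S x‖) :
    ∃ V : H₁ →L[ℂ] H₂, IsPartialIsometry V ∧
      LinearMap.ker (V : H₁ →ₗ[ℂ] H₂) = LinearMap.ker (S : H₁ →ₗ[ℂ] H₁) ∧ T = V.comp S := by
  set N := LinearMap.ker (S : H₁ →ₗ[ℂ] H₁) with hN
  have hSN : ∀ x, S x ∈ Nᗮ := fun x => by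
    rw [hS.orthogonal_ker]; exact Submodule.le_topologicalClosure _ ⟨x, rfl⟩
  have : CompleteSpace N := S.isClosed_ker.completeSpace_coe
  set s : H₁ →ₗ[ℂ] Nᗮ := (S : H₁ →ₗ[ℂ] H₁).codRestrict Nᗮ hSN with hs
  have hdense : DenseRange s := by
    intro y
    have hy : (y : H₁) ∈ closure (Set.range S) := by
      have hy' : (y : H₁) ∈ (LinearMap.range (S : H₁ →ₗ[ℂ] H₁)).topologicalClosure :=
        hS.orthogonal_ker ▸ y.2
      exact hy'
    rw [Metric.mem_closure_iff] at hy ⊢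
    intro ε hε
    obtain ⟨_, ⟨x, rfl⟩, hx⟩ := hy ε hε
    exact ⟨s x, ⟨x, rfl⟩, hx⟩
  have hTs : ∀ x, ‖(T : H₁ →ₗ[ℂ] H₂) x‖ ≤ 1 * ‖s x‖ := fun x => by
    rw [one_mul]; exact (h x).le
  set U : Nᗮ →L[ℂ] H₂ := (T : H₁ →ₗ[ℂ] H₂).extendOfNorm s with hU
  have hUs : ∀ x, U (s x) = T x := LinearMap.extendOfNorm_eq hdense ⟨1, hTs⟩
  have hUn : ∀ y, ‖U y‖ = ‖y‖ := fun y => by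
    refine hdense.induction_on (p := fun y => ‖U y‖ = ‖y‖) y
      (isClosed_eq (by fun_prop) (by fun_prop)) fun x => ?_
    rw [hUs]; exact h x
  have hVn : ∀ x, ‖(U.comp Nᗮ.orthogonalProjectionOnto) x‖ = ‖Nᗮ.orthogonalProjectionOnto x‖ :=
    fun x => hUn _
  have hker : LinearMap.ker ((U.comp Nᗮ.orthogonalProjectionOnto : H₁ →L[ℂ] H₂) : H₁ →ₗ[ℂ] H₂)
      = N := by
    ext x
    rw [LinearMap.mem_ker, ContinuousLinearMap.coe_coe, ← norm_eq_zero, hVn, norm_eq_zero,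
      Submodule.orthogonalProjectionOnto_eq_zero_iff, Submodule.orthogonal_orthogonal]
  refine ⟨U.comp Nᗮ.orthogonalProjectionOnto, fun x hx => ?_, hker, ?_⟩
  · rw [hker] at hx
    rw [hVn]
    exact congrArg norm (Submodule.orthogonalProjectionOnto_mem_subspace_eq_self (⟨x, hx⟩ : Nᗮ))
  · ext x
    rw [comp_apply, comp_apply, ← hUs]
    exact congrArg U (Submodule.orthogonalProjectionOnto_mem_subspace_eq_self (s x)).symm

lemma IsAbsolutelyMinimumAttaining.exists_isAMDecomposition (hH₁ : ¬ FiniteDimensional ℂ H₁)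
    {T : H₁ →L[ℂ] H₂} (hT : IsAbsolutelyMinimumAttaining T) :
    ∃ (V : H₁ →L[ℂ] H₂) (α : ℝ) (K F : H₁ →L[ℂ] H₁), IsAMDecomposition T V α K F := by
  set S := CFC.sqrt ((adjoint T).comp T) with hSdef
  have hSp : S.IsPositive := (nonneg_iff_isPositive S).1 (CFC.sqrt_nonneg _)
  have hSS : ∀ x, S (S x) = adjoint T (T x) := DFunLike.congr_fun
    (CFC.sqrt_mul_sqrt_self ((adjoint T).comp T)
      ((nonneg_iff_isPositive _).2 (isPositive_adjoint_comp_self T)))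
  have hST : ∀ x, ‖S x‖ = ‖T x‖ := fun x => by
    have h : ⟪S x, S x⟫_ℂ = ⟪T x, T x⟫_ℂ := by
      rw [← hSp.inner_left_eq_inner_right, hSS, adjoint_inner_left]
    rw [@norm_eq_sqrt_re_inner ℂ, @norm_eq_sqrt_re_inner ℂ _ _ _ _ (T x), h]
  obtain ⟨α, K, F, hKc, hK, hα, hFf, hF, hKF, hFK, hSeq⟩ :=
    (hT.congr_norm hST).exists_compact_finiteRank hH₁ hSp
  obtain ⟨V, hV, hker, hTV⟩ :=
    exists_partialIsometry_comp_eq hSp.isSelfAdjoint fun x => (hST x).symm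
  rw [hSeq] at hker hTV
  exact ⟨V, α, K, F, hKc, hK, hα, hFf, hF, hKF, hFK, hV, hker, hTV⟩

end Polar

theorem mainTheorem2 {H₁ H₂ : Type*}
    [NormedAddCommGroup H₁] [InnerProductSpace ℂ H₁] [CompleteSpace H₁]
    [NormedAddCommGroup H₂] [InnerProductSpace ℂ H₂] [CompleteSpace H₂]
    (hH₁ : ¬ FiniteDimensional ℂ H₁) (hH₂ : ¬ FiniteDimensional ℂ H₂)
    (T : H₁ →L[ℂ] H₂) :
    (IsAbsolutelyMinimumAttaining T ↔
      ∃ (V : H₁ →L[ℂ] H₂) (α : ℝ) (K F : H₁ →L[ℂ] H₁), IsAMDecomposition T V α K F) ∧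
    (∀ (V V' : H₁ →L[ℂ] H₂) (α α' : ℝ) (K K' F F' : H₁ →L[ℂ] H₁),
      IsAMDecomposition T V α K F → IsAMDecomposition T V' α' K' F' →
        V = V' ∧ α = α' ∧ K = K' ∧ F = F') :=
  ⟨⟨fun hT => hT.exists_isAMDecomposition hH₁,
    fun ⟨_, _, _, _, h⟩ => h.isAbsolutelyMinimumAttaining⟩,
    fun _ _ _ _ _ _ _ _ h h' => h.unique hH₁ h'⟩
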